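/- Let $D \subseteq \mathbb{R}^d$ be open with boundary $\partial D$ (for instance a bounded Lipschitz domain). Let $H(D)$ and $H_{\mathcal A}(D)$ be real vector spaces of functions $D \to \mathbb{R}$ (for instance Hilbert spaces of functions), let $\mathcal{A} : H(D) \to H_{\mathcal A}(D)$ be a linear operator and $\mathcal{B}$ a linear operator from $H(D)$ to functions on $\partial D$. Let $\mathcal{A}_\Lambda$ be a linear operator from $H_{\mathcal A}(D)$ to the distributions on $D$, and $\mathcal{B}_\Lambda$ a linear operator from a linear subspace of $H_{\mathcal A}(D)$ to functions on $\partial D$ (the condition $\mathcal{B}_\Lambda g = 0$ includes that $g$ lies in this subspace). Put $$H_\Lambda(D) = \{ g \in H_{\mathcal A}(D) : \mathcal{A}_\Lambda g \in L^2(D),\ \mathcal{B}_\Lambda g = 0 \text{ on } \partial D\}, \qquad \langle f, g\rangle_\Lambda = \int_D (\mathcal{A}_\Lambda f)(\mathcal{A}_\Lambda g)\, dx,$$ $$H_k(D) = \{ v \in H(D) : \mathcal{A}_\Lambda \mathcal{A} v \in L^2(D),\ \mathcal{B} v = 0 \text{ on } \partial D,\ \mathcal{B}_\Lambda \mathcal{A}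 v = 0 \text{ on } \partial D\}, \qquad \langle u, v\rangle_k = \int_D (\mathcal{A}_\Lambda \mathcal{A} u)(\mathcal{A}_\Lambda \mathcal{A} v)\, dx .$$ Let $\Lambda : D \times D \to \mathbb{R}$ be the covariance function whose reproducing kernel Hilbert space is $H_\Lambda(D)$, that is, $(H_\Lambda(D), \langle\cdot,\cdot\rangle_\Lambda)$ is a reproducing kernel Hilbert space of functions on $D$ with reproducing kernel $\Lambda$. Suppose that the problem is well-posed: for every $g \in H_\Lambda(D)$ there is a unique $u \in H_k(D)$ with $\mathcal{A} u = g$. Let $G : D \times D \to \mathbb{R}$ be a Green's function of the system, that is, $\mathcal{A} G(\cdot, z) = \delta(\cdot - z)$ in $D$ and $\mathcal{B} G(\cdot, z) = 0$ on $\partial D$, in the following weak sense: for every $g \in H_\Lambda(D)$ the function $z \mapsto G(x,z) g(z)$ is integrable over $D$ for each $x \in D$, and $x \mapsto \int_D G(x,z) g(z)\, dz$ is an element of $H(D)$ which $\mathcal{A}$ maps to $g$ and $\mathcal{B}$ maps to $0$. Define the natural kernel $$k(x,x') = \int_D \int_D G(x,z)\, G(x',z')\, \Lambda(z,z')\, dz\,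 dz' ,$$ and assume that $\int_D k(x,x)^{1/2}\, dx < \infty$. Then, for all $x, x' \in D$, the iterated integral that defines $k(x,x')$ converges, and $(H_k(D), \langle\cdot,\cdot\rangle_k)$ is a reproducing kernel Hilbert space of functions on $D$ with reproducing kernel $k$. -/

import Mathlib

open MeasureTheory TopologicalSpace
open scoped Distributions

noncomputable section

namespace NaturalKernel

/-! ### Reproducing kernel Hilbert spaces -/

/-- Let `V` be a real vector space of functions on `X` (each `v : V` is the function `ev v`), with a
bilinear form `form`.  `IsRKHSWithKernel ev form k` says that `V`, with the inner product `form`, is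
a reproducing kernel Hilbert space of functions on `X` (complete, with continuous point
evaluations; Mathlib's `RKHS`), and that `k` is its reproducing kernel. -/
def IsRKHSWithKernel {X V : Type} [AddCommGroup V] [Module ℝ V]
    (ev : V →ₗ[ℝ] (X → ℝ)) (form : V → V → ℝ) (k : X → X → ℝ) : Prop :=
  ∃ (E : Type) (_ : NormedAddCommGroup E) (_ : InnerProductSpace ℝ E) (_ : CompleteSpace E)
    (_ : RKHS ℝ E X ℝ) (e : V ≃ₗ[ℝ] E),
    (∀ v x, e v x = ev v x) ∧
    (∀ u v, inner ℝ (e u) (e v) = form u v) ∧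
    ∀ x y, RKHS.kernel E x y 1 = k x y

/-! ### Square-integrable distributions -/

variable {d : ℕ} {D : Opens (EuclideanSpace ℝ (Fin d))}

/-- Lebesgue measure on the open set `D`. -/
instance : MeasureSpace D := Measure.Subtype.measureSpace

/-- The distribution `T` on `D` is given by the function `f ∈ L²(D)`. -/
def IsGivenBy (T : 𝓓'(D, ℝ)) (f : Lp ℝ 2 (volume : Measure D)) : Prop :=
  ∀ φ : 𝓓(D, ℝ), T φ = ∫ x : D, f x * φ x

lemma integrable_mul_test (f : Lp ℝ 2 (volume : Measure D)) (φ : 𝓓(D, ℝ)) :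
    Integrable (fun x : D => f x * φ x) (volume : Measure D) := by
  have h1 : MemLp (fun x : EuclideanSpace ℝ (Fin d) => φ x) 2
      ((volume : Measure (EuclideanSpace ℝ (Fin d))).restrict D) :=
    (φ.continuous.memLp_of_hasCompactSupport φ.hasCompactSupport).restrict _
  have h2 : MemLp (fun x : D => φ x) 2 (volume : Measure D) :=
    h1.comp_measurePreserving (measurePreserving_subtype_coe D.isOpen.measurableSet)
  exact (Lp.memLp f).integrable_mul h2

/-- The distributions on `D` that belong to `L²(D)`. -/
def l2Distributions (D : Opens (EuclideanSpace ℝ (Fin d))) : Submodule ℝ 𝓓'(D, ℝ) where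
  carrier := {T | ∃ f, IsGivenBy T f}
  zero_mem' := by
    refine ⟨0, fun φ => ?_⟩
    have h : (fun x : D => (0 : Lp ℝ 2 (volume : Measure D)) x * φ x) =ᵐ[volume] fun _ => 0 := by
      filter_upwards [Lp.coeFn_zero ℝ 2 (volume : Measure D)] with x hx
      rw [hx, Pi.zero_apply, zero_mul]
    rw [integral_congr_ae h, integral_zero]
    rfl
  add_mem' := by
    rintro S T ⟨f, hf⟩ ⟨g, hg⟩
    refine ⟨f + g, fun φ => ?_⟩
    have h : (fun x : D => (f + g) x * φ x) =ᵐ[volume] fun x => f x * φ x + g x * φ x := by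
      filter_upwards [Lp.coeFn_add f g] with x hx
      rw [hx, Pi.add_apply, add_mul]
    rw [integral_congr_ae h, integral_add (integrable_mul_test f φ) (integrable_mul_test g φ),
      ← hf φ, ← hg φ]
    rfl
  smul_mem' := by
    rintro c T ⟨f, hf⟩
    refine ⟨c • f, fun φ => ?_⟩
    have h : (fun x : D => (c • f) x * φ x) =ᵐ[volume] fun x => c * (f x * φ x) := by
      filter_upwards [Lp.coeFn_smul c f] with x hx
      rw [hx, Pi.smul_apply, smul_eq_mul, mul_assoc]
    rw [integral_congr_ae h, integral_const_mul, ← hf φ]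
    rfl

open Classical in
/-- The function in `L²(D)` which gives the distribution `T` (`0` if there is none). -/
def l2Function (T : 𝓓'(D, ℝ)) : Lp ℝ 2 (volume : Measure D) :=
  if h : ∃ f, IsGivenBy T f then h.choose else 0

/-- The `L²(D)` inner product of two square-integrable distributions. -/
def l2Inner (S T : 𝓓'(D, ℝ)) : ℝ := ∫ x : D, l2Function S x * l2Function T x

/-! ### The function spaces and the Green's function -/

/-- The space of those elements of the domain of a partially defined linear operator at which the
operator vanishes. -/
def pKer {V W : Type*} [AddCommGroup V] [Module ℝ V] [AddCommGroup W] [Module ℝ W]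
    (T : V →ₗ.[ℝ] W) : Submodule ℝ V :=
  (LinearMap.ker T.toFun).map T.domain.subtype

/-- `H_Λ(D)`: the `g ∈ H_𝒜(D)` with `𝒜_Λ g ∈ L²(D)` and `ℬ_Λ g = 0` on `∂D`. -/
def spaceΛ {HA : Submodule ℝ (D → ℝ)} (AΛ : HA →ₗ[ℝ] 𝓓'(D, ℝ))
    (BΛ : HA →ₗ.[ℝ] (frontier (D : Set (EuclideanSpace ℝ (Fin d))) → ℝ)) : Submodule ℝ HA :=
  (l2Distributions D).comap AΛ ⊓ pKer BΛ

/-- `H_k(D)`: the `v ∈ H(D)` with `𝒜_Λ 𝒜 v ∈ L²(D)`, `ℬ v = 0` on `∂D` and `ℬ_Λ 𝒜 v = 0` on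
`∂D`. -/
def spaceK {H HA : Submodule ℝ (D → ℝ)} (A : H →ₗ[ℝ] HA)
    (B : H →ₗ[ℝ] (frontier (D : Set (EuclideanSpace ℝ (Fin d))) → ℝ))
    (AΛ : HA →ₗ[ℝ] 𝓓'(D, ℝ))
    (BΛ : HA →ₗ.[ℝ] (frontier (D : Set (EuclideanSpace ℝ (Fin d))) → ℝ)) : Submodule ℝ H :=
  (l2Distributions D).comap (AΛ ∘ₗ A) ⊓ LinearMap.ker B ⊓ (pKer BΛ).comap A

/-- `G` is a Green's function of the system `(𝒜, ℬ)`, with the space `S` of right hand sides: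
`𝒜 G(·, z) = δ(· - z)` in `D` and `ℬ G(·, z) = 0` on `∂D`.  Since `G(·, z)` need not lie in the
domain `H` of `𝒜`, this has its usual weak meaning, in which both equations are integrated over
`z` against an arbitrary `g ∈ S`: the superposition `x ↦ ∫ G(x, z) g(z) dz` lies in `H`, `𝒜` maps
it to `∫ δ(· - z) g(z) dz = g`, and `ℬ` maps it to `0`. -/
def IsGreenFunction {H HA : Submodule ℝ (D → ℝ)} (A : H →ₗ[ℝ] HA)
    (B : H →ₗ[ℝ] (frontier (D : Set (EuclideanSpace ℝ (Fin d))) → ℝ))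
    (S : Submodule ℝ HA) (G : D → D → ℝ) : Prop :=
  ∀ g ∈ S, (∀ x, Integrable (fun z : D => G x z * (g : D → ℝ) z)) ∧
    ∃ u : H, (∀ x, (u : D → ℝ) x = ∫ z : D, G x z * (g : D → ℝ) z) ∧ A u = g ∧ B u = 0

/-- The natural kernel `k(x, x') = ∬ G(x, z) G(x', z') Λ(z, z') dz dz'`. -/
def naturalKernel (G Λ : D → D → ℝ) (x x' : D) : ℝ :=
  ∫ z' : D, ∫ z : D, G x z * G x' z' * Λ z z'

end NaturalKernel

end

/-! Well-posedness makes `A` a bijection from H_k(D) onto H_Λ(D), and the form on H_k(D) is the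
pullback of the form on H_Λ(D); so H_k(D) is a Hilbert space, realised in the same `E`. With κ_z
representing evaluation at z on H_Λ(D), the Green's function gives v(x) = ∫ G(x,z) ⟨κ_z, Av⟩ dz.
Evaluation at x is thus represented by the weak integral r_x = ∫ G(x,z) κ_z dz, which exists by
`exists_inner_eq_integral`, and ⟨r_x, r_x'⟩ is the iterated integral k(x,x'). -/

namespace NaturalKernel

/-! ### Weak integrals in Hilbert spaces -/

/-- A function with values in a Hilbert space whose inner products with all vectors are integrable
has a weak integral. -/
theorem exists_inner_eq_integral {X E : Type*} [MeasurableSpace X] {μ : Measure X}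
    [NormedAddCommGroup E] [InnerProductSpace ℝ E] [CompleteSpace E] (φ : X → E)
    (hφ : ∀ f, Integrable (fun z => inner ℝ (φ z) f) μ) :
    ∃ r : E, ∀ f, inner ℝ r f = ∫ z, inner ℝ (φ z) f ∂μ := by
  let T : E →ₗ[ℝ] Lp ℝ 1 μ :=
    { toFun := fun f => (hφ f).toL1 _
      map_add' := fun f g => by
        rw [← Integrable.toL1_add]
        congr 1
        ext z
        simp [inner_add_right]
      map_smul' := fun c f => by
        rw [RingHom.id_apply, ← Integrable.toL1_smul]
        congr 1
        ext z
        simp [inner_smul_right] }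
  -- Closed graph theorem: an L¹ limit of `T (u n)` is an a.e. limit along a subsequence, while ⟨φ
  -- z, u n⟩ → ⟨φ z, f⟩ for every z.
  have hT : Continuous T := by
    refine T.continuous_of_seq_closed_graph fun u f g hu hg => ?_
    obtain ⟨ns, hns, hae⟩ := (tendstoInMeasure_of_tendsto_Lp hg).exists_seq_tendsto_ae
    refine Lp.ext ?_
    have hcoe : ∀ᵐ z ∂μ, ∀ n, T (u n) z = inner ℝ (φ z) (u n) :=
      ae_all_iff.2 fun n => (hφ (u n)).coeFn_toL1
    filter_upwards [hae, hcoe, (hφ f).coeFn_toL1] with z hz hc hf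
    refine (tendsto_nhds_unique hz ?_).trans hf.symm
    simp only [Function.comp_apply, hc]
    exact ((continuous_const.inner continuous_id).tendsto f).comp
      (hu.comp hns.tendsto_atTop)
  let L : E →L[ℝ] ℝ := L1.integralCLM.comp ⟨T, hT⟩
  refine ⟨(InnerProductSpace.toDual ℝ E).symm L, fun f => ?_⟩
  rw [InnerProductSpace.toDual_symm_apply]
  change L1.integralCLM ((hφ f).toL1 _) = _
  rw [← L1.integral_eq, L1.integral_eq_integral]
  exact integral_congr_ae (hφ f).coeFn_toL1

/-! ### Reproducing kernel Hilbert spaces through representers of the evaluations -/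

section Representers

variable {X V : Type} [AddCommGroup V] [Module ℝ V] {ev : V →ₗ[ℝ] (X → ℝ)} {form : V → V → ℝ}
  {k : X → X → ℝ}

/-- In a reproducing kernel Hilbert space the evaluations are represented by vectors, whose inner
products form the kernel. -/
theorem IsRKHSWithKernel.exists_representers (h : IsRKHSWithKernel ev form k) :
    ∃ (E : Type) (_ : NormedAddCommGroup E) (_ : InnerProductSpace ℝ E) (_ : CompleteSpace E)
      (e : V ≃ₗ[ℝ] E) (κ : X → E), (∀ v x, inner ℝ (κ x) (e v) = ev v x) ∧
      (∀ u v, inner ℝ (e u) (e v) = form u v) ∧ ∀ x y, inner ℝ (κ x) (κ y) = k x y := by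
  obtain ⟨E, _, _, _, _, e, hev, hform, hker⟩ := h
  refine ⟨E, inferInstance, inferInstance, inferInstance, e, fun x => RKHS.kerFun E x 1,
    fun v x => ?_, hform, fun x y => ?_⟩
  · rw [RKHS.kerFun_inner, hev]
    simp
  · rw [RKHS.kerFun_inner, RKHS.kerFun_apply, hker]
    simp

/-- A Hilbert space of functions whose evaluations are represented by vectors is a reproducing
kernel Hilbert space, and the inner products of these vectors form its kernel. -/
theorem isRKHSWithKernel_of_representers {E : Type} [NormedAddCommGroup E] [InnerProductSpace ℝ E]
    [CompleteSpace E] (e : V ≃ₗ[ℝ] E) (κ : X → E) (hinj : Function.Injective ev)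
    (hev : ∀ v x, inner ℝ (κ x) (e v) = ev v x)
    (hform : ∀ u v, inner ℝ (e u) (e v) = form u v) (hker : ∀ x y, inner ℝ (κ x) (κ y) = k x y) :
    IsRKHSWithKernel ev form k := by
  have hcoe : ∀ f x, inner ℝ (κ x) f = ev (e.symm f) x := fun f x => by
    rw [← hev, e.apply_symm_apply]
  let R : RKHS ℝ E X ℝ :=
    { coeCLM := ContinuousLinearMap.pi fun x => innerSL ℝ (κ x)
      coeCLM_injective := fun f g hfg => by
        refine e.symm.injective (hinj (funext fun x => ?_))
        rw [← hcoe, ← hcoe]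
        exact congrFun hfg x }
  have happ : ∀ (f : E) (x : X), f x = inner ℝ (κ x) f := fun _ _ => rfl
  -- Both vectors represent evaluation at `y`.
  have hfun : ∀ y, RKHS.kerFun E y (1 : ℝ) = κ y := fun y => by
    refine ext_inner_right ℝ fun f => ?_
    rw [RKHS.kerFun_inner, happ]
    simp
  refine ⟨E, inferInstance, inferInstance, inferInstance, R, e, fun v x => ?_, hform,
    fun x y => ?_⟩
  · rw [happ, hev]
  · rw [← RKHS.kerFun_apply, hfun, happ, hker]

end Representers

/-! ### The solution operator -/

variable {d : ℕ} {D : Opens (EuclideanSpace ℝ (Fin d))} {H HA : Submodule ℝ (D → ℝ)}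
  {A : H →ₗ[ℝ] HA} {B : H →ₗ[ℝ] (frontier (D : Set (EuclideanSpace ℝ (Fin d))) → ℝ)}
  {AΛ : HA →ₗ[ℝ] 𝓓'(D, ℝ)}
  {BΛ : HA →ₗ.[ℝ] (frontier (D : Set (EuclideanSpace ℝ (Fin d))) → ℝ)}

theorem mem_spaceK_iff {u : H} : u ∈ spaceK A B AΛ BΛ ↔ A u ∈ spaceΛ AΛ BΛ ∧ B u = 0 := by
  simp only [spaceK, spaceΛ, Submodule.mem_inf, Submodule.mem_comap, LinearMap.mem_ker,
    LinearMap.comp_apply]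
  tauto

/-- For a well-posed problem, `A` is a linear bijection from `H_k(D)` onto `H_Λ(D)`. -/
noncomputable def spaceKEquiv (hwp : ∀ g ∈ spaceΛ AΛ BΛ, ∃! u : H, u ∈ spaceK A B AΛ BΛ ∧ A u = g) :
    spaceK A B AΛ BΛ ≃ₗ[ℝ] spaceΛ AΛ BΛ :=
  LinearEquiv.ofBijective (A.restrict fun _ hu => (mem_spaceK_iff.1 hu).1) <| by
    refine ⟨fun u v huv => ?_, fun g => ?_⟩
    · have hA : A u = A v := congrArg Subtype.val huv
      exact Subtype.ext ((hwp _ (mem_spaceK_iff.1 v.2).1).unique ⟨u.2, hA⟩ ⟨v.2, rfl⟩)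
    · obtain ⟨u, ⟨hu, hA⟩, -⟩ := hwp g g.2
      exact ⟨⟨u, hu⟩, Subtype.ext hA⟩

/-- Elements of `H_k(D)` are recovered from the Green's function. -/
theorem IsGreenFunction.apply_eq_integral {G : D → D → ℝ}
    (hG : IsGreenFunction A B (spaceΛ AΛ BΛ) G)
    (hwp : ∀ g ∈ spaceΛ AΛ BΛ, ∃! u : H, u ∈ spaceK A B AΛ BΛ ∧ A u = g)
    {v : H} (hv : v ∈ spaceK A B AΛ BΛ) (x : D) :
    (v : D → ℝ) x = ∫ z : D, G x z * (A v : D → ℝ) z := by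
  have hAv := (mem_spaceK_iff.1 hv).1
  obtain ⟨-, u, hu, hAu, hBu⟩ := hG _ hAv
  -- The Green superposition solves the same problem as `v`, so uniqueness identifies them.
  have huK : u ∈ spaceK A B AΛ BΛ := mem_spaceK_iff.2 ⟨hAu ▸ hAv, hBu⟩
  rw [← hu, (hwp _ hAv).unique ⟨hv, rfl⟩ ⟨huK, hAu⟩]

end NaturalKernel

theorem mainTheorem6 {d : ℕ} (D : Opens (EuclideanSpace ℝ (Fin d)))
    -- the function spaces `H(D)`, `H_𝒜(D)` and the operators `𝒜`, `ℬ`, `𝒜_Λ`, `ℬ_Λ`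
    (H HA : Submodule ℝ (D → ℝ))
    (A : H →ₗ[ℝ] HA)
    (B : H →ₗ[ℝ] (frontier (D : Set (EuclideanSpace ℝ (Fin d))) → ℝ))
    (AΛ : HA →ₗ[ℝ] 𝓓'(D, ℝ))
    (BΛ : HA →ₗ.[ℝ] (frontier (D : Set (EuclideanSpace ℝ (Fin d))) → ℝ))
    -- `H_Λ(D)` is the reproducing kernel Hilbert space of the covariance function `Λ`
    (Λ : D → D → ℝ)
    (hΛ : NaturalKernel.IsRKHSWithKernel
      (HA.subtype.domRestrict (NaturalKernel.spaceΛ AΛ BΛ))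
      (fun f g : NaturalKernel.spaceΛ AΛ BΛ => NaturalKernel.l2Inner (AΛ f.1) (AΛ g.1)) Λ)
    -- the problem is well-posed
    (hwp : ∀ g ∈ NaturalKernel.spaceΛ AΛ BΛ,
      ∃! u : H, u ∈ NaturalKernel.spaceK A B AΛ BΛ ∧ A u = g)
    (G : D → D → ℝ)
    (hG : NaturalKernel.IsGreenFunction A B (NaturalKernel.spaceΛ AΛ BΛ) G)
    (hk : Integrable (fun x : D => Real.sqrt (NaturalKernel.naturalKernel G Λ x x))) :
    -- the iterated integral that defines `k` converges
    (∀ x x' : D, (∀ z' : D, Integrable (fun z : D => G x z * G x' z' * Λ z z')) ∧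
      Integrable (fun z' : D => ∫ z : D, G x z * G x' z' * Λ z z')) ∧
    -- `H_k(D)` is a reproducing kernel Hilbert space with reproducing kernel `k`
    NaturalKernel.IsRKHSWithKernel
      (H.subtype.domRestrict (NaturalKernel.spaceK A B AΛ BΛ))
      (fun u v : NaturalKernel.spaceK A B AΛ BΛ => NaturalKernel.l2Inner (AΛ (A u.1)) (AΛ (A v.1)))
      (NaturalKernel.naturalKernel G Λ) := by
  obtain ⟨E, _, _, _, e, κ, hev, hform, hker⟩ := hΛ.exists_representers
  have hκ : ∀ f z, inner ℝ (κ z) f = ((e.symm f).1 : D → ℝ) z := fun f z => by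
    simpa using hev (e.symm f) z
  have hint : ∀ x f, Integrable (fun z : D => G x z * inner ℝ (κ z) f) := fun x f => by
    simpa only [hκ] using (hG _ (e.symm f).2).1 x
  have hr : ∀ x, ∃ r : E, ∀ f, inner ℝ r f = ∫ z : D, G x z * inner ℝ (κ z) f := fun x => by
    simpa only [inner_smul_left, RCLike.conj_to_real] using
      NaturalKernel.exists_inner_eq_integral (fun z : D => G x z • κ z)
        (by simpa only [inner_smul_left, RCLike.conj_to_real] using hint x)
  choose r hr using hr
  have hsplit : ∀ x x' z z' : D,
      G x z * G x' z' * Λ z z' = G x' z' * (G x z * inner ℝ (κ z) (κ z')) := fun x x' z z' => by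
    rw [hker]
    ring
  -- The inner integral tests r_x against κ_z', so it is G(x',z') times the value at z' of an
  -- element of H_Λ(D). The outer integral is then again of the Green type and converges.
  have hinner : ∀ x x' z' : D,
      ∫ z : D, G x z * G x' z' * Λ z z' = G x' z' * inner ℝ (κ z') (r x) := fun x x' z' => by
    simp only [hsplit]
    rw [integral_const_mul, ← hr, real_inner_comm]
  refine ⟨fun x x' => ⟨fun z' => ?_, ?_⟩, ?_⟩
  · simp only [hsplit]
    exact (hint x (κ z')).const_mul _
  · simp only [hinner]
    exact hint x' (r x)
  -- The isometry onto `E` is v ↦ `e (A v)`, so `hform` at `A u`, `A v` is the required identity.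
  · refine NaturalKernel.isRKHSWithKernel_of_representers
      ((NaturalKernel.spaceKEquiv hwp).trans e) r
      (fun u v huv => Subtype.ext (Subtype.ext huv)) (fun v x => ?_) (fun u v => hform _ _)
      (fun x x' => ?_)
    · rw [hr]
      simp only [hκ, LinearEquiv.trans_apply, LinearEquiv.symm_apply_apply]
      exact (hG.apply_eq_integral hwp v.2 x).symm
    · simp only [NaturalKernel.naturalKernel, hinner]
      rw [← hr, real_inner_comm]
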